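/- **Setting (one view of ProBFT with a Byzantine leader).** There are $n$ replicas, of which a fixed set $\Pi_F$ with $|\Pi_F|\le f<n/3$ is Byzantine; the other replicas are correct. Fix constants $o>1$ and $l\ge 1$. The quorum size $q$ and the sample size $s\le n$ are integers equal to $l\sqrt n$ and $o\,q$ up to rounding: $|q-l\sqrt n|<1$ and $|s-o\,q|<1$. A verifiable random function assigns to every replica $j$ a prepare sample $S_p(j)$ and a commit sample $S_c(j)$; these $2n$ samples are independent, and each is uniform among all sets of $s$ distinct replicas. Messages of $j$ in a phase, even if $j$ is Byzantine, are accepted only by members of the sample of $j$ for that phase. In the view, a correct replica $i$ that is not blocked * *votes* for the first safe proposal $x$ that it receives with the signature of the leader, and then sends a Prepare message for $x$ to $S_p(i)$; * *prepares* the value $x$ it voted for once it has received Prepare messages for $x$ from $q$ distinct replicas, and then sends a Commit message for $x$ to $S_c(i)$; * *decides* its prepared value $x$ once it has received Commit messages for $x$ from $q$ distinct replicas; * *blocks* the view (takes no further step in it) when it receives, after its vote, a message with a different value signed by the leader. The adversary controls the leader, which is Byzantine and may send any number of different proposals to any replicas, the other Byzantine replicas, which may send Prepare and Commit messages for any values to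 the members of their samples, and the delivery of all messages (asynchronous network). It acts adaptively. It knows all past events, the samples of the Byzantine replicas from the start, and the prepare (commit) sample of a correct replica once that replica has sent its Prepare (Commit) messages; it cannot predict the other samples. *Agreement is violated in the view* if two correct replicas decide different values in it. **Theorem.** Let $o>1$, $l\ge 1$ and $\delta_0>0$ be constants. There is a function $g$ with $g(n)=\Theta(\sqrt n)$ as $n\to\infty$, depending only on $o,l,\delta_0$, such that for all $n,f,q,s$ as above that satisfy $$\delta:=\frac{n}{o\,r}-1\ \ge\ \delta_0,\qquad r:=\frac{n-f}{2}+f=\frac{n+f}{2},$$ for every set of proposed values, every choice of the Byzantine set and of the Byzantine leader, and every adversary as above, the probability (over the samples) that agreement is violated in the view is at most $$\bigl(\exp(-g(n))\bigr)^4 .$$ In particular this holds for the adversary whose leader splits the correct replicas into two halves $\Pi_C^1,\Pi_C^2$ and sends one value to $\Pi_C^1\cup\Pi_F$ and another one to $\Pi_C^2\cup\Pi_F$. -/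

import Mathlib

open MeasureTheory ProbabilityTheory Asymptotics Filter

namespace ProBFT

/-- The two sampled phases of a view (the seed of the verifiable random function is
`view || phase`, so every replica has one sample per phase). -/
inductive Phase : Type
  | prepare : Phase
  | commit : Phase

/-- A recipient sample: a set of exactly `s` distinct replicas out of `n`. -/
abbrev Sample (n s : ℕ) : Type := {S : Finset (Fin n) // S.card = s}

/-- The outcome of all verifiable random functions in the view: one sample for each phase and
each replica (correct or Byzantine). -/
def Samples (n s : ℕ) : Type := Phase → Fin n → Sample n s

instance (n s : ℕ) : MeasurableSpace (Samples n s) := ⊤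

/-- The law of the samples. It is the uniform distribution on the (finite) product space
`Samples n s`: the `2 * n` samples are independent, and each one is uniform among all sets of `s`
distinct replicas. -/
noncomputable def samplesLaw (n s : ℕ) : Measure (Samples n s) := uniformOn Set.univ

/-- The data of a view that are fixed before it starts. -/
structure View (n : ℕ) (V : Type*) where
  /-- the set of Byzantine replicas (static corruption) -/
  byz : Finset (Fin n)
  /-- the leader of the view -/
  leader : Fin n
  /-- the single value that the leader proposes if it is correct -/
  leaderVal : V
  /-- the values for which a proposal of this view can pass the test `safeProposal` -/
  safe : V → Prop

/-- The variables of a correct replica in the view. -/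
structure LocalState (V : Type*) where
  /-- `curVal`; it is `none` as long as the replica has not voted -/
  curVal : Option V
  /-- whether `curVal` has been prepared in this view -/
  prepared : Bool
  /-- the value decided in this view, if any -/
  decided : Option V
  /-- `blockView` -/
  blocked : Bool

/-- A global state: the entries of Byzantine replicas are never used. -/
abbrev State (n : ℕ) (V : Type*) : Type _ := Fin n → LocalState V

/-- All replicas have just entered the view. -/
def initState (n : ℕ) (V : Type*) : State n V := fun _ => ⟨none, false, none, false⟩

/-- The events that can happen at a replica `i`; they are the message handlers of the protocol. -/
inductive Action (n : ℕ) (V : Type*) : Type _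
  /-- `i` receives from the leader a proposal of the value `x` -/
  | propose (i : Fin n) (x : V) : Action n V
  /-- `i` has received matching Prepare messages from the probabilistic quorum `Q` -/
  | prepareQuorum (i : Fin n) (Q : Finset (Fin n)) : Action n V
  /-- `i` has received matching Commit messages from the probabilistic quorum `Q` -/
  | commitQuorum (i : Fin n) (Q : Finset (Fin n)) : Action n V
  /-- `i` receives, in a message of any type and from anybody, the value `x` signed by the leader,
  which differs from the value that `i` voted for -/
  | conflict (i : Fin n) (x : V) : Action n V

section Protocol

variable {n s : ℕ} {V : Type*}

/-- `x` can carry the leader's signature for this view: a correct leader signs one value only, a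
Byzantine leader as many as it wishes. -/
def View.Signed (W : View n V) (x : V) : Prop := W.leader ∈ W.byz ∨ x = W.leaderVal

/-- Replica `j` has sent, or (if Byzantine) may send, a Prepare message for `x` to its prepare
sample. A correct replica does so exactly when it votes. -/
def SentPrepare (W : View n V) (σ : State n V) (j : Fin n) (x : V) : Prop :=
  (j ∈ W.byz ∧ W.Signed x) ∨ (j ∉ W.byz ∧ (σ j).curVal = some x)

/-- Replica `j` has sent, or (if Byzantine) may send, a Commit message for `x` to its commit
sample. A correct replica does so exactly when it prepares. -/
def SentCommit (W : View n V) (σ : State n V) (j : Fin n) (x : V) : Prop :=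
  (j ∈ W.byz ∧ W.Signed x) ∨ (j ∉ W.byz ∧ (σ j).prepared = true ∧ (σ j).curVal = some x)

/-- The preconditions of the handlers. Only handlers of correct replicas are run; a message of
replica `j` is accepted by `i` only if `i` belongs to the sample of `j` for the phase, whoever `j`
is. The network is asynchronous: a message that has been sent may be received at any time. -/
def Enabled (W : View n V) (q : ℕ) (ω : Samples n s) (σ : State n V) : Action n V → Prop
  | .propose i x =>
      i ∉ W.byz ∧ (σ i).blocked = false ∧ (σ i).curVal = none ∧ W.Signed x ∧ W.safe x
  | .prepareQuorum i Q =>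
      i ∉ W.byz ∧ (σ i).blocked = false ∧ Q.card = q ∧
        ∃ x, (σ i).curVal = some x ∧ ∀ j ∈ Q, SentPrepare W σ j x ∧ i ∈ (ω .prepare j).1
  | .commitQuorum i Q =>
      i ∉ W.byz ∧ (σ i).blocked = false ∧ (σ i).prepared = true ∧ Q.card = q ∧
        ∃ x, (σ i).curVal = some x ∧ ∀ j ∈ Q, SentCommit W σ j x ∧ i ∈ (ω .commit j).1
  | .conflict i x =>
      i ∉ W.byz ∧ (σ i).blocked = false ∧ W.Signed x ∧ ∃ y, (σ i).curVal = some y ∧ x ≠ y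

/-- The effects of the handlers: vote, prepare, decide `curVal`, block the view. -/
def effect (σ : State n V) : Action n V → State n V
  | .propose i x => Function.update σ i { σ i with curVal := some x }
  | .prepareQuorum i _ => Function.update σ i { σ i with prepared := true }
  | .commitQuorum i _ => Function.update σ i { σ i with decided := (σ i).curVal }
  | .conflict i _ => Function.update σ i { σ i with blocked := true }

open Classical in
/-- One step: an action whose precondition fails changes nothing. -/
noncomputable def step (W : View n V) (q : ℕ) (ω : Samples n s) (σ : State n V)
    (a : Action n V) : State n V :=
  if Enabled W q ω σ a then effect σ a else σ

/-- The samples that have been disclosed in the state `σ`: those of the Byzantine replicas from the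
start, and the prepare (commit) sample of a correct replica once it has sent its Prepare (Commit)
messages. -/
def Disclosed (W : View n V) (σ : State n V) : Phase → Fin n → Prop
  | .prepare, j => j ∈ W.byz ∨ (σ j).curVal ≠ none
  | .commit, j => j ∈ W.byz ∨ (σ j).prepared = true

open Classical in
/-- What the adversary knows about the samples in the state `σ`. -/
noncomputable def observe (W : View n V) (ω : Samples n s) (σ : State n V) :
    Phase → Fin n → Option (Sample n s) :=
  fun p j => if Disclosed W σ p j then some (ω p j) else none

/-- An adversary. It controls the Byzantine leader, the other Byzantine replicas and the delivery of
messages: from the past actions (latest first) and the disclosed samples it chooses the next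
action. It cannot predict samples of correct replicas that have not been disclosed. -/
def Adversary (n s : ℕ) (V : Type*) : Type _ :=
  List (Action n V) → (Phase → Fin n → Option (Sample n s)) → Action n V

/-- The history of actions and the state after `t` steps. -/
noncomputable def run (W : View n V) (q : ℕ) (A : Adversary n s V) (ω : Samples n s) :
    ℕ → List (Action n V) × State n V
  | 0 => ([], initState n V)
  | t + 1 =>
      let h := (run W q A ω t).1
      let σ := (run W q A ω t).2
      let a := A h (observe W ω σ)
      (a :: h, step W q ω σ a)

/-- Two correct replicas have decided different values. -/
def Disagreement (W : View n V) (σ : State n V) : Prop :=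
  ∃ i j x y, i ∉ W.byz ∧ j ∉ W.byz ∧ (σ i).decided = some x ∧ (σ j).decided = some y ∧ x ≠ y

/-- The probability that agreement is violated in the view, against the adversary `A`. -/
noncomputable def violationProb (W : View n V) (q : ℕ) (A : Adversary n s V) : ℝ :=
  (samplesLaw n s).real {ω | ∃ t, Disagreement W (run W q A ω t).2}

end Protocol

end ProBFT

/-! A violation needs two different prepared values. Their supporter sets (voters and Byzantine
replicas) meet only in the Byzantine set, so one has at most `(n + |byz|) / 2` members, yet `q` of
these hit one common replica `i` with their prepare samples. The expected number of hits is about `q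
/ (1 + δ)` or less, so a Chernoff bound should give `exp (-c q)`, and the commit samples are not
needed.

The difficulty is adaptivity: the adversary chooses the supporters while it watches samples. But a
correct replica's prepare sample is disclosed only by its vote, so it is independent of the run up
to then (`run_resample`). With weights of mean one, each vote multiplies the tilt of its value by a
fresh factor of mean one. There can be up to `n` voted values, chosen adaptively; `potential` pays
for each new one by giving every non-voter the tilt of the Byzantine set in advance. The result is a
supermartingale with initial mean `n` (`potential_propose_le`, `sum_potential_run_le`). On a
violation it is exponentially large for some `i` (`le_tilt_hitWeight`). Markov's inequality after
summing over `i` gives a bound with prefactor `n ^ 2`, which the exponential in `√n` absorbs. -/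

namespace ProBFT

/-! ### Independence of samples, by exchanging one with a fresh copy. -/

section Resampling

variable {n s : ℕ}

noncomputable instance : Fintype (Samples n s) := by
  classical
  have : Fintype Phase := ⟨{.prepare, .commit}, fun p => by cases p <;> simp⟩
  unfold Samples
  infer_instance

/-- Replace the prepare sample of the replica `j` by `S`. -/
def resample (ω : Samples n s) (j : Fin n) (S : Sample n s) : Samples n s
  | .prepare => Function.update (ω .prepare) j S
  | .commit => ω .commit

@[simp] lemma resample_prepare_self (ω : Samples n s) (j : Fin n) (S : Sample n s) :
    resample ω j S .prepare j = S := by simp [resample]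

lemma resample_prepare_of_ne (ω : Samples n s) {j k : Fin n} (h : k ≠ j) (S : Sample n s) :
    resample ω j S .prepare k = ω .prepare k := by simp [resample, h]

@[simp] lemma resample_resample_self (ω : Samples n s) (j : Fin n) (S : Sample n s) :
    resample (resample ω j S) j (ω .prepare j) = ω := by
  funext p
  cases p <;> simp [resample]

/-- Exchange the prepare sample of `j` with a fresh one. -/
def exchangeSample (j : Fin n) : Samples n s × Sample n s ≃ Samples n s × Sample n s where
  toFun x := (resample x.1 j x.2, x.1 .prepare j)
  invFun x := (resample x.1 j x.2, x.1 .prepare j)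
  left_inv x := by simp
  right_inv x := by simp

/-- A factor of mean zero that depends on the prepare sample of `j` only kills every factor that
does not depend on that sample. -/
lemma sum_mul_eq_zero_of_resample (j : Fin n) (h : Samples n s → ℝ) (φ : Sample n s → ℝ)
    (hh : ∀ ω S, h (resample ω j S) = h ω) (hφ : ∑ S, φ S = 0) :
    ∑ ω, h ω * φ (ω .prepare j) = 0 := by
  have key : ∑ x : Samples n s × Sample n s, h x.1 * φ (x.1 .prepare j) = 0 := by
    rw [← Equiv.sum_comp (exchangeSample j), Fintype.sum_prod_type]
    simp [exchangeSample, hh, ← Finset.mul_sum, hφ]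
  rw [Fintype.sum_prod_type] at key
  simp only [Finset.sum_const, nsmul_eq_mul, ← Finset.mul_sum] at key
  -- The pair sum carries a factor `card (Sample n s)`. It vanishes only if there are no samples,
  -- and then there is no `ω` either.
  rcases mul_eq_zero.1 key with h0 | h0
  · have : IsEmpty (Sample n s) := by
      rw [← Fintype.card_eq_zero_iff]
      exact_mod_cast h0
    exact Finset.sum_eq_zero fun ω _ => isEmptyElim (ω .prepare j)
  · exact h0

/-- The product of the weights of the prepare samples of the members of `T`. -/
noncomputable def tilt (w : Sample n s → ℝ) (ω : Samples n s) (T : Finset (Fin n)) : ℝ :=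
  ∏ j ∈ T, w (ω .prepare j)

lemma tilt_nonneg {w : Sample n s → ℝ} (hw : ∀ S, 0 ≤ w S) (ω : Samples n s)
    (T : Finset (Fin n)) : 0 ≤ tilt w ω T :=
  Finset.prod_nonneg fun _ _ => hw _

lemma tilt_resample (w : Sample n s → ℝ) (ω : Samples n s) {T : Finset (Fin n)} {j : Fin n}
    (hj : j ∉ T) (S : Sample n s) : tilt w (resample ω j S) T = tilt w ω T :=
  Finset.prod_congr rfl fun k hk => by
    rw [resample_prepare_of_ne _ (ne_of_mem_of_not_mem hk hj)]

/-- By independence the mean of a product of mean-one weights over a fixed set is one; this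
evaluates the initial potential. -/
lemma sum_tilt {w : Sample n s → ℝ} (hw : ∑ S, (w S - 1) = 0) (T : Finset (Fin n)) :
    ∑ ω, tilt w ω T = Fintype.card (Samples n s) := by
  classical
  induction T using Finset.induction_on with
  | empty => simp [tilt]
  | insert a T ha ih =>
    have h0 := sum_mul_eq_zero_of_resample a (fun ω => tilt w ω T) (fun S => w S - 1)
      (fun ω S => tilt_resample w ω ha S) hw
    rw [← ih, ← sub_eq_zero, ← Finset.sum_sub_distrib, ← h0]
    refine Finset.sum_congr rfl fun ω _ => ?_
    simp only [tilt, Finset.prod_insert ha]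
    ring

end Resampling

/-! ### The potential and its change under a vote. -/

section Potential

variable {n s : ℕ} {V : Type*}

open Classical in
/-- The replicas that have sent, or may send, a Prepare message for a signed value `x`. -/
noncomputable def supporters (W : View n V) (σ : State n V) (x : V) : Finset (Fin n) :=
  Finset.univ.filter fun j => j ∈ W.byz ∨ (σ j).curVal = some x

open Classical in
/-- The values that have a vote. -/
noncomputable def votedValues (σ : State n V) : Finset V :=
  Finset.univ.biUnion fun j => (σ j).curVal.toFinset

/-- The replicas that have not voted. -/
noncomputable def nonVoters (σ : State n V) : Finset (Fin n) :=
  Finset.univ.filter fun j => (σ j).curVal = none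

/-- The sum of the tilts of all values with a vote, where every replica that has not voted stands
for one more value, which has the support of the Byzantine replicas only. -/
noncomputable def potential (w : Sample n s → ℝ) (W : View n V) (ω : Samples n s)
    (σ : State n V) : ℝ :=
  ∑ x ∈ votedValues σ, tilt w ω (supporters W σ x) + (nonVoters σ).card * tilt w ω W.byz

lemma mem_supporters {W : View n V} {σ : State n V} {x : V} {j : Fin n} :
    j ∈ supporters W σ x ↔ j ∈ W.byz ∨ (σ j).curVal = some x := by simp [supporters]

lemma mem_votedValues {σ : State n V} {x : V} :
    x ∈ votedValues σ ↔ ∃ j, (σ j).curVal = some x := by simp [votedValues]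

lemma mem_nonVoters {σ : State n V} {j : Fin n} :
    j ∈ nonVoters σ ↔ (σ j).curVal = none := by simp [nonVoters]

lemma potential_congr (w : Sample n s → ℝ) (W : View n V) (ω : Samples n s) {σ σ' : State n V}
    (h : ∀ j, (σ' j).curVal = (σ j).curVal) : potential w W ω σ' = potential w W ω σ := by
  have h1 : supporters W σ' = supporters W σ := by
    ext x j
    simp only [mem_supporters, h]
  simp only [potential, votedValues, nonVoters, h1, h]

lemma tilt_le_potential {w : Sample n s → ℝ} (hw : ∀ S, 0 ≤ w S) (W : View n V)
    (ω : Samples n s) {σ : State n V} {x : V} (hx : x ∈ votedValues σ) :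
    tilt w ω (supporters W σ x) ≤ potential w W ω σ := by
  have h1 := Finset.single_le_sum (f := fun x => tilt w ω (supporters W σ x))
    (fun x _ => tilt_nonneg hw ω _) hx
  have h2 : 0 ≤ ((nonVoters σ).card : ℝ) * tilt w ω W.byz :=
    mul_nonneg (Nat.cast_nonneg _) (tilt_nonneg hw ω _)
  simp only [potential]
  linarith

lemma potential_nonneg {w : Sample n s → ℝ} (hw : ∀ S, 0 ≤ w S) (W : View n V)
    (ω : Samples n s) (σ : State n V) : 0 ≤ potential w W ω σ :=
  add_nonneg (Finset.sum_nonneg fun _ _ => tilt_nonneg hw ω _)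
    (mul_nonneg (Nat.cast_nonneg _) (tilt_nonneg hw ω _))

/-- A vote removes one non-voter, hence one reserve copy of the Byzantine tilt. For a new value that
copy becomes the old tilt of `x`, with equality; for a value already voted it is dropped, being
nonnegative. -/
lemma potential_propose_le {w : Sample n s → ℝ} (hw : ∀ S, 0 ≤ w S) (W : View n V)
    (ω : Samples n s) {σ : State n V} {i : Fin n} (hi : i ∉ W.byz) (hv : (σ i).curVal = none)
    (x : V) :
    potential w W ω (effect σ (.propose i x)) ≤
      potential w W ω σ + tilt w ω (supporters W σ x) * (w (ω .prepare i) - 1) := by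
  classical
  set σ' := effect σ (.propose i x) with hσ'
  have hself : (σ' i).curVal = some x := by simp [hσ', effect]
  have hne : ∀ j, j ≠ i → (σ' j).curVal = (σ j).curVal := fun j hj => by
    simp [hσ', effect, hj]
  have hsx : supporters W σ' x = insert i (supporters W σ x) := by
    ext j
    by_cases hj : j = i
    · subst hj; simp [mem_supporters, hself]
    · simp [mem_supporters, hne j hj, hj]
  have hix : i ∉ supporters W σ x := by simp [mem_supporters, hi, hv]
  have hsy : ∀ y, y ≠ x → supporters W σ' y = supporters W σ y := by
    intro y hy
    ext j
    by_cases hj : j = i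
    · subst hj; simp [mem_supporters, hself, hv, hy.symm]
    · simp [mem_supporters, hne j hj]
  have hvals : votedValues σ' = insert x (votedValues σ) := by
    ext y
    simp only [mem_votedValues, Finset.mem_insert]
    constructor
    · rintro ⟨j, hj⟩
      by_cases hji : j = i
      · subst hji
        rw [hself] at hj
        exact Or.inl (Option.some.inj hj).symm
      · exact Or.inr ⟨j, by rw [← hne j hji, hj]⟩
    · rintro (rfl | ⟨j, hj⟩)
      · exact ⟨i, hself⟩
      · have hji : j ≠ i := by rintro rfl; simp [hv] at hj
        exact ⟨j, by rw [hne j hji, hj]⟩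
  have hnon : nonVoters σ = insert i (nonVoters σ') := by
    ext j
    by_cases hj : j = i
    · subst hj; simp [mem_nonVoters, hv]
    · simp [mem_nonVoters, hne j hj, hj]
  have hni : i ∉ nonVoters σ' := by simp [mem_nonVoters, hself]
  have htx : tilt w ω (supporters W σ' x) = tilt w ω (supporters W σ x) * w (ω .prepare i) := by
    rw [hsx, tilt, Finset.prod_insert hix, mul_comm, tilt]
  have hbyz := tilt_nonneg hw ω W.byz
  have hcard : ((nonVoters σ).card : ℝ) = (nonVoters σ').card + 1 := by
    rw [hnon, Finset.card_insert_of_notMem hni]; push_cast; rfl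
  have hrest : ∑ y ∈ (votedValues σ).erase x, tilt w ω (supporters W σ' y) =
      ∑ y ∈ (votedValues σ).erase x, tilt w ω (supporters W σ y) :=
    Finset.sum_congr rfl fun y hy => by rw [hsy y (Finset.ne_of_mem_erase hy)]
  simp only [potential, hvals, hcard]
  by_cases hx : x ∈ votedValues σ
  · rw [Finset.insert_eq_self.2 hx, ← Finset.add_sum_erase _ _ hx,
      ← Finset.add_sum_erase (votedValues σ) _ hx, hrest, htx]
    linarith
  · have hsup : supporters W σ x = W.byz := by
      ext j
      have : (σ j).curVal ≠ some x := fun h => hx (mem_votedValues.2 ⟨j, h⟩)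
      simp [mem_supporters, this]
    rw [Finset.erase_eq_of_notMem hx] at hrest
    rw [Finset.sum_insert hx, hrest, htx, hsup]
    linarith

end Potential

/-! ### Runs against an adaptive adversary: supermartingale bound and invariants. -/

section Run

variable {n s : ℕ} {V : Type*}

/-- The action that the adversary chooses after `t` steps. -/
noncomputable def nextAction (W : View n V) (q : ℕ) (A : Adversary n s V) (ω : Samples n s)
    (t : ℕ) : Action n V :=
  A (run W q A ω t).1 (observe W ω (run W q A ω t).2)

lemma run_succ_fst (W : View n V) (q : ℕ) (A : Adversary n s V) (ω : Samples n s) (t : ℕ) :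
    (run W q A ω (t + 1)).1 = nextAction W q A ω t :: (run W q A ω t).1 := rfl

lemma run_succ_snd (W : View n V) (q : ℕ) (A : Adversary n s V) (ω : Samples n s) (t : ℕ) :
    (run W q A ω (t + 1)).2 =
      step W q ω (run W q A ω t).2 (nextAction W q A ω t) := rfl

lemma curVal_step (W : View n V) (q : ℕ) (ω : Samples n s) (σ : State n V) (a : Action n V)
    {j : Fin n} {x : V} (h : (σ j).curVal = some x) :
    (step W q ω σ a j).curVal = some x := by
  unfold step
  split_ifs with hE
  · cases a with
    | propose i y =>
      have hji : j ≠ i := by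
        rintro rfl
        have := hE.2.2.1
        simp [h] at this
      simpa [effect, hji] using h
    | prepareQuorum i Q =>
      by_cases hji : j = i
      · subst hji; simpa [effect] using h
      · simpa [effect, hji] using h
    | commitQuorum i Q =>
      by_cases hji : j = i
      · subst hji; simpa [effect] using h
      · simpa [effect, hji] using h
    | conflict i y =>
      by_cases hji : j = i
      · subst hji; simpa [effect] using h
      · simpa [effect, hji] using h
  · exact h

lemma observe_resample (W : View n V) (ω : Samples n s) (σ : State n V) {j : Fin n}
    (hj : j ∉ W.byz) (hv : (σ j).curVal = none) (S : Sample n s) :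
    observe W (resample ω j S) σ = observe W ω σ := by
  funext p k
  cases p with
  | commit => rfl
  | prepare =>
    by_cases hk : k = j
    · subst hk
      simp [observe, Disclosed, hj, hv]
    · simp [observe, resample_prepare_of_ne _ hk]

/-- A prepare quorum consists of replicas that may have sent Prepare messages, so a correct
non-voter is in none, and no other guard reads prepare samples. -/
lemma enabled_resample (W : View n V) (q : ℕ) (ω : Samples n s) (σ : State n V) {j : Fin n}
    (hj : j ∉ W.byz) (hv : (σ j).curVal = none) (S : Sample n s) (a : Action n V) :
    Enabled W q (resample ω j S) σ a ↔ Enabled W q ω σ a := by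
  cases a with
  | propose i x => rfl
  | conflict i x => rfl
  | commitQuorum i Q => rfl
  | prepareQuorum i Q =>
    have key : ∀ (x : V) (k : Fin n),
        (SentPrepare W σ k x ∧ i ∈ (resample ω j S .prepare k).1) ↔
          (SentPrepare W σ k x ∧ i ∈ (ω .prepare k).1) := by
      intro x k
      by_cases hk : k = j
      · subst hk
        simp [SentPrepare, hj, hv]
      · rw [resample_prepare_of_ne _ hk]
    simp only [Enabled, key]

/-- The prepare sample of a correct replica that has not voted has no influence on the run. -/
lemma run_resample (W : View n V) (q : ℕ) (A : Adversary n s V) (ω : Samples n s) {j : Fin n}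
    (hj : j ∉ W.byz) (S : Sample n s) (t : ℕ) (hv : ((run W q A ω t).2 j).curVal = none) :
    run W q A (resample ω j S) t = run W q A ω t := by
  induction t with
  | zero => rfl
  | succ t ih =>
    have hv' : ((run W q A ω t).2 j).curVal = none := by
      by_contra h
      obtain ⟨x, hx⟩ := Option.ne_none_iff_exists'.1 h
      have := curVal_step W q ω _ (nextAction W q A ω t) hx
      rw [← run_succ_snd, hv] at this
      cases this
    have ih := ih hv'
    have hact : nextAction W q A (resample ω j S) t = nextAction W q A ω t := by
      rw [nextAction, ih, observe_resample W ω _ hj hv' S, nextAction]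
    refine Prod.ext ?_ ?_
    · rw [run_succ_fst, run_succ_fst, hact, ih]
    · rw [run_succ_snd, run_succ_snd, hact, ih]
      unfold step
      congr 1
      exact propext (enabled_resample W q ω _ hj hv' S _)

open Classical in
/-- The tilt of the value that `j` votes for in step `t`; it is zero if `j` does not vote then. -/
noncomputable def voteTilt (w : Sample n s → ℝ) (W : View n V) (q : ℕ) (A : Adversary n s V)
    (t : ℕ) (j : Fin n) (ω : Samples n s) : ℝ :=
  match nextAction W q A ω t with
  | .propose i x =>
      if i = j ∧ Enabled W q ω (run W q A ω t).2 (.propose i x) then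
        tilt w ω (supporters W (run W q A ω t).2 x)
      else 0
  | _ => 0

lemma voteTilt_eq_zero (w : Sample n s → ℝ) (W : View n V) (q : ℕ) (A : Adversary n s V)
    (t : ℕ) (j : Fin n) (ω : Samples n s)
    (h : ¬ (j ∉ W.byz ∧ ((run W q A ω t).2 j).curVal = none)) :
    voteTilt w W q A t j ω = 0 := by
  unfold voteTilt
  split
  · refine if_neg ?_
    rintro ⟨rfl, hE⟩
    exact h ⟨hE.1, hE.2.2.1⟩
  · rfl

/-- Up to the vote of `j` the run ignores the sample of `j`, and the tilt is taken over the
supporters before the vote, which exclude `j`. So the coefficient of the fresh factor is determined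
by the other samples. -/
lemma voteTilt_resample (w : Sample n s → ℝ) (W : View n V) (q : ℕ) (A : Adversary n s V)
    (t : ℕ) (j : Fin n) (ω : Samples n s) (S : Sample n s) :
    voteTilt w W q A t j (resample ω j S) = voteTilt w W q A t j ω := by
  by_cases h : j ∉ W.byz ∧ ((run W q A ω t).2 j).curVal = none
  · obtain ⟨hj, hv⟩ := h
    have hrun := run_resample W q A ω hj S t hv
    have hact : nextAction W q A (resample ω j S) t = nextAction W q A ω t := by
      rw [nextAction, hrun, observe_resample W ω _ hj hv S, nextAction]
    unfold voteTilt
    rw [hact, hrun]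
    cases nextAction W q A ω t with
    | propose i x =>
      have hT : j ∉ supporters W (run W q A ω t).2 x := by simp [mem_supporters, hj, hv]
      dsimp only
      rw [tilt_resample w ω hT]
      congr 1
    | _ => rfl
  -- Putting the old sample back undoes the resampling, so `j` is a correct non-voter in one run
  -- exactly when it is in the other; both sides vanish.
  · rw [voteTilt_eq_zero w W q A t j ω h, voteTilt_eq_zero]
    rintro ⟨hj, hv⟩
    refine h ⟨hj, ?_⟩
    have := run_resample W q A (resample ω j S) hj (ω .prepare j) t hv
    rw [resample_resample_self] at this
    rw [this, hv]

/-- The sum over `j` has at most one nonzero term. Splitting by voter gives increments in which the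
identity of the fresh sample is fixed. -/
lemma potential_run_succ_le {w : Sample n s → ℝ} (hw : ∀ S, 0 ≤ w S) (W : View n V) (q : ℕ)
    (A : Adversary n s V) (t : ℕ) (ω : Samples n s) :
    potential w W ω (run W q A ω (t + 1)).2 ≤ potential w W ω (run W q A ω t).2 +
      ∑ j, voteTilt w W q A t j ω * (w (ω .prepare j) - 1) := by
  rw [run_succ_snd]
  unfold voteTilt
  by_cases hE : Enabled W q ω (run W q A ω t).2 (nextAction W q A ω t)
  · rw [step, if_pos hE]
    cases ha : nextAction W q A ω t with
    | propose i x =>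
      rw [ha] at hE
      refine (potential_propose_le hw W ω hE.1 hE.2.2.1 x).trans_eq ?_
      congr 1
      rw [Finset.sum_eq_single i]
      · simp [hE]
      · intro j _ hj
        simp [hj.symm]
      · simp
    | _ =>
      simp only [zero_mul, Finset.sum_const_zero, add_zero]
      refine (potential_congr w W ω fun j => ?_).le
      simp only [effect, Function.update_apply]
      split_ifs with h
      · rw [h]
      · rfl
  · rw [step, if_neg hE]
    refine (add_zero _).symm.trans_le (add_le_add le_rfl (le_of_eq ?_))
    symm
    refine Finset.sum_eq_zero fun j _ => ?_
    cases ha : nextAction W q A ω t with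
    | propose i x =>
      rw [ha] at hE
      simp [hE]
    | _ => simp

lemma sum_potential_run_le {w : Sample n s → ℝ} (hw : ∀ S, 0 ≤ w S) (hw1 : ∑ S, (w S - 1) = 0)
    (W : View n V) (q : ℕ) (A : Adversary n s V) (t : ℕ) :
    ∑ ω, potential w W ω (run W q A ω t).2 ≤ n * Fintype.card (Samples n s) := by
  induction t with
  | zero =>
    refine le_of_eq ?_
    have h0 : ∀ ω : Samples n s,
        potential w W ω (run W q A ω 0).2 = n * tilt w ω W.byz := by
      intro ω
      have hvals : votedValues (run W q A ω 0).2 = ∅ :=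
        Finset.eq_empty_of_forall_notMem fun x hx => by
          simp [mem_votedValues, run, initState] at hx
      rw [potential, hvals]
      simp [run, initState, nonVoters]
    simp only [h0, ← Finset.mul_sum, sum_tilt hw1]
  | succ t ih =>
    refine (Finset.sum_le_sum fun ω _ => potential_run_succ_le hw W q A t ω).trans ?_
    rw [Finset.sum_add_distrib, Finset.sum_comm]
    rw [Finset.sum_eq_zero (f := fun j => ∑ ω, _) fun j _ =>
      sum_mul_eq_zero_of_resample j (voteTilt w W q A t j) (fun S => w S - 1)
        (fun ω S => voteTilt_resample w W q A t j ω S) hw1]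
    simpa using ih

/-- What holds for every correct replica in every reachable state. -/
structure Invariant (W : View n V) (q : ℕ) (ω : Samples n s) (σ : State n V) : Prop where
  prepared : ∀ i, (σ i).prepared = true → ∃ x, (σ i).curVal = some x ∧
    ∃ Q ⊆ supporters W σ x, Q.card = q ∧ ∀ j ∈ Q, i ∈ (ω .prepare j).1
  decided : ∀ i x, (σ i).decided = some x → (σ i).prepared = true ∧ (σ i).curVal = some x

lemma supporters_subset_step (W : View n V) (q : ℕ) (ω : Samples n s) (σ : State n V)
    (a : Action n V) (x : V) : supporters W σ x ⊆ supporters W (step W q ω σ a) x := by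
  intro j hj
  rw [mem_supporters] at hj ⊢
  exact hj.imp_right (curVal_step W q ω σ a)

lemma prepared_step (W : View n V) (q : ℕ) (ω : Samples n s) (σ : State n V) (a : Action n V)
    {i : Fin n} (h : (step W q ω σ a i).prepared = true) :
    (σ i).prepared = true ∨ ∃ Q, a = .prepareQuorum i Q ∧ Enabled W q ω σ a := by
  unfold step at h
  split_ifs at h with hE
  · cases a with
    | prepareQuorum k Q =>
      by_cases hk : i = k
      · subst hk; exact Or.inr ⟨Q, rfl, hE⟩
      · left; simpa [effect, hk] using h
    | propose k _ =>
      left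
      by_cases hk : i = k
      · subst hk; simpa [effect] using h
      · simpa [effect, hk] using h
    | commitQuorum k _ =>
      left
      by_cases hk : i = k
      · subst hk; simpa [effect] using h
      · simpa [effect, hk] using h
    | conflict k _ =>
      left
      by_cases hk : i = k
      · subst hk; simpa [effect] using h
      · simpa [effect, hk] using h
  · exact Or.inl h

lemma prepared_step_of_prepared (W : View n V) (q : ℕ) (ω : Samples n s) (σ : State n V)
    (a : Action n V) {i : Fin n} (h : (σ i).prepared = true) :
    (step W q ω σ a i).prepared = true := by
  unfold step
  split_ifs with hE
  · cases a <;> simp only [effect, Function.update_apply] <;> split_ifs with hk <;>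
      first | exact h | rfl | (subst hk; exact h)
  · exact h

lemma decided_step (W : View n V) (q : ℕ) (ω : Samples n s) (σ : State n V) (a : Action n V)
    {i : Fin n} {x : V} (h : (step W q ω σ a i).decided = some x) :
    (σ i).decided = some x ∨ ((σ i).prepared = true ∧ (σ i).curVal = some x) := by
  unfold step at h
  split_ifs at h with hE
  · cases a with
    | commitQuorum k Q =>
      by_cases hk : i = k
      · subst hk
        exact Or.inr ⟨hE.2.2.1, by simpa [effect] using h⟩
      · left; simpa [effect, hk] using h
    | propose k _ =>
      left
      by_cases hk : i = k
      · subst hk; simpa [effect] using h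
      · simpa [effect, hk] using h
    | prepareQuorum k _ =>
      left
      by_cases hk : i = k
      · subst hk; simpa [effect] using h
      · simpa [effect, hk] using h
    | conflict k _ =>
      left
      by_cases hk : i = k
      · subst hk; simpa [effect] using h
      · simpa [effect, hk] using h
  · exact Or.inl h

lemma Invariant.step {W : View n V} {q : ℕ} {ω : Samples n s} {σ : State n V}
    (h : Invariant W q ω σ) (a : Action n V) : Invariant W q ω (step W q ω σ a) where
  prepared i hi := by
    have hσ : ∃ x, (σ i).curVal = some x ∧
        ∃ Q ⊆ supporters W σ x, Q.card = q ∧ ∀ j ∈ Q, i ∈ (ω .prepare j).1 := by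
      rcases prepared_step W q ω σ a hi with hp | ⟨Q, rfl, hE⟩
      · exact h.prepared i hp
      · obtain ⟨-, -, hQ, x, hx, hall⟩ := hE
        refine ⟨x, hx, Q, fun j hj => ?_, hQ, fun j hj => (hall j hj).2⟩
        rw [mem_supporters]
        exact (hall j hj).1.imp (·.1) (·.2)
    obtain ⟨x, hx, Q, hQ, hc, hall⟩ := hσ
    exact ⟨x, curVal_step W q ω σ a hx, Q,
      hQ.trans (supporters_subset_step W q ω σ a x), hc, hall⟩
  decided i x hi := by
    have hσ : (σ i).prepared = true ∧ (σ i).curVal = some x :=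
      (decided_step W q ω σ a hi).elim (h.decided i x) id
    exact ⟨prepared_step_of_prepared W q ω σ a hσ.1, curVal_step W q ω σ a hσ.2⟩

lemma invariant_run (W : View n V) (q : ℕ) (A : Adversary n s V) (ω : Samples n s) (t : ℕ) :
    Invariant W q ω (run W q A ω t).2 := by
  induction t with
  | zero => exact ⟨fun i h => by simp [run, initState] at h, fun i x h => by
      simp [run, initState] at h⟩
  | succ t ih => exact ih.step _

/-- A repeated commit quorum overwrites `decided` by `curVal`, which the invariant shows to be the
same value. -/
lemma Invariant.decided_step_of_decided {W : View n V} {q : ℕ} {ω : Samples n s}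
    {σ : State n V} (h : Invariant W q ω σ) (a : Action n V) {i : Fin n} {x : V}
    (hi : (σ i).decided = some x) : (ProBFT.step W q ω σ a i).decided = some x := by
  have hv := (h.decided i x hi).2
  unfold ProBFT.step
  split_ifs with hE
  · cases a <;> simp only [effect, Function.update_apply] <;> split_ifs with hk <;>
      first | exact hi | (subst hk; first | exact hi | exact hv)
  · exact hi

lemma disagreement_run_mono (W : View n V) (q : ℕ) (A : Adversary n s V) (ω : Samples n s) :
    Monotone fun t => Disagreement W (run W q A ω t).2 := by
  refine monotone_nat_of_le_succ fun t => ?_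
  rintro ⟨i, j, x, y, hi, hj, hx, hy, hxy⟩
  have h := invariant_run W q A ω t
  exact ⟨i, j, x, y, hi, hj, h.decided_step_of_decided _ hx, h.decided_step_of_decided _ hy, hxy⟩

/-- When agreement is violated, some replica has a prepare quorum for a value whose supporters are
at most half of the correct replicas and the Byzantine ones. -/
lemma Invariant.exists_minority_quorum {W : View n V} {q : ℕ} {ω : Samples n s}
    {σ : State n V} (h : Invariant W q ω σ) (hd : Disagreement W σ) :
    ∃ i, ∃ x ∈ votedValues σ, 2 * (supporters W σ x).card ≤ n + W.byz.card ∧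
      ∃ Q ⊆ supporters W σ x, Q.card = q ∧ ∀ j ∈ Q, i ∈ (ω .prepare j).1 := by
  classical
  obtain ⟨i, j, x, y, -, -, hx, hy, hxy⟩ := hd
  obtain ⟨hpi, hvi⟩ := h.decided i x hx
  obtain ⟨hpj, hvj⟩ := h.decided j y hy
  obtain ⟨x', hx', hQx⟩ := h.prepared i hpi
  obtain ⟨y', hy', hQy⟩ := h.prepared j hpj
  obtain rfl : x = x' := Option.some.inj (hvi.symm.trans hx')
  obtain rfl : y = y' := Option.some.inj (hvj.symm.trans hy')
  -- A correct replica votes for one value only.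
  have hinter : supporters W σ x ∩ supporters W σ y ⊆ W.byz := by
    intro k hk
    rw [Finset.mem_inter, mem_supporters, mem_supporters] at hk
    obtain ⟨h1 | h1, h2 | h2⟩ := hk
    · exact h1
    · exact h1
    · exact h2
    · exact absurd (Option.some.inj (h1.symm.trans h2)) hxy
  have hsum := Finset.card_union_add_card_inter (supporters W σ x) (supporters W σ y)
  have h1 := Finset.card_le_card hinter
  have h2 := Finset.card_le_univ (supporters W σ x ∪ supporters W σ y)
  rw [Fintype.card_fin] at h2
  rcases le_total (supporters W σ x).card (supporters W σ y).card with hle | hle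
  · exact ⟨i, x, mem_votedValues.2 ⟨i, hvi⟩, by omega, hQx⟩
  · exact ⟨j, y, mem_votedValues.2 ⟨j, hvj⟩, by omega, hQy⟩

end Run

/-! ### Exponential weights and the Chernoff bound. -/

section Bound

variable {n s : ℕ} {V : Type*}

/-- Transposing `i` and `k` permutes the samples. -/
lemma sum_mem_sample_eq (i k : Fin n) :
    ∑ S : Sample n s, (if i ∈ S.1 then (1 : ℝ) else 0) =
      ∑ S : Sample n s, (if k ∈ S.1 then (1 : ℝ) else 0) := by
  let e : Sample n s ≃ Sample n s :=
    (Equiv.finsetCongr (Equiv.swap i k)).subtypeEquiv fun S => by simp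
  rw [← Equiv.sum_comp e]
  refine Finset.sum_congr rfl fun S _ => ?_
  have : i ∈ (e S).1 ↔ k ∈ S.1 := by
    simp [e, Finset.mem_map_equiv]
  simp only [this]

/-- A uniform sample contains a given replica with probability `s / n`. -/
lemma sum_mem_sample (i : Fin n) :
    ∑ S : Sample n s, (if i ∈ S.1 then (1 : ℝ) else 0) =
      Fintype.card (Sample n s) * (s / n) := by
  have h1 : ∑ k : Fin n, ∑ S : Sample n s, (if k ∈ S.1 then (1 : ℝ) else 0) =
      Fintype.card (Sample n s) * s := by
    rw [Finset.sum_comm]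
    simp [fun S : Sample n s => S.2]
  have hn : (n : ℝ) ≠ 0 := by exact_mod_cast (Fin.pos i).ne'
  rw [Finset.sum_congr rfl fun k _ => sum_mem_sample_eq (s := s) k i] at h1
  simp only [Finset.sum_const, Finset.card_univ, Fintype.card_fin, nsmul_eq_mul] at h1
  field_simp
  linarith

/-- The normalized exponential weight of a sample that counts whether it contains `i`. -/
noncomputable def hitWeight (ε : ℝ) (i : Fin n) (S : Sample n s) : ℝ :=
  (1 + ε * if i ∈ S.1 then 1 else 0) / (1 + ε * (s / n))

lemma hitWeight_nonneg {ε : ℝ} (hε : 0 < ε) (i : Fin n) (S : Sample n s) :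
    0 ≤ hitWeight ε i S := by
  unfold hitWeight
  split_ifs <;> positivity

lemma sum_hitWeight_sub_one {ε : ℝ} (hε : 0 < ε) (i : Fin n) :
    ∑ S : Sample n s, (hitWeight ε i S - 1) = 0 := by
  have h : (1 + ε * (s / n : ℝ)) ≠ 0 := by positivity
  simp only [hitWeight, Finset.sum_sub_distrib, ← Finset.sum_div, Finset.sum_add_distrib,
    ← Finset.mul_sum, sum_mem_sample]
  simp only [Finset.sum_const, Finset.card_univ, nsmul_eq_mul, mul_one]
  field_simp
  ring

/-- Numerators are `1 + ε` on `Q` and at least one elsewhere; the common denominator is at least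
one, so its exponent may be raised from `T.card` to `m`. -/
lemma le_tilt_hitWeight {ε : ℝ} (hε : 0 < ε) (i : Fin n) (ω : Samples n s)
    {Q T : Finset (Fin n)} (hQT : Q ⊆ T) (hQ : ∀ j ∈ Q, i ∈ (ω .prepare j).1) {m : ℕ}
    (hm : T.card ≤ m) :
    (1 + ε) ^ Q.card / (1 + ε * (s / n)) ^ m ≤ tilt (hitWeight ε i) ω T := by
  have hb : (1 : ℝ) ≤ 1 + ε * (s / n) := le_add_of_nonneg_right (by positivity)
  unfold tilt hitWeight
  rw [Finset.prod_div_distrib, Finset.prod_const]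
  have h1 : (1 + ε) ^ Q.card ≤ ∏ j ∈ T, (1 + ε * if i ∈ (ω .prepare j).1 then (1 : ℝ) else 0) := by
    rw [← Finset.prod_const]
    have h2 : ∏ _j ∈ Q, (1 + ε) =
        ∏ j ∈ Q, (1 + ε * if i ∈ (ω .prepare j).1 then (1 : ℝ) else 0) :=
      Finset.prod_congr rfl fun j hj => by simp [hQ j hj]
    rw [h2]
    refine Finset.prod_le_prod_of_subset_of_one_le hQT (fun j _ => ?_) fun j _ _ => ?_ <;>
      split_ifs <;> (simp [hε.le]; try positivity)
  gcongr

/-- Markov's inequality for the uniform law. -/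
lemma samplesLaw_real_le {E : Set (Samples n s)} {F : Samples n s → ℝ} {a C : ℝ} (ha : 0 < a)
    (hF : ∀ ω, 0 ≤ F ω) (hE : ∀ ω ∈ E, a ≤ F ω) (hC : 0 ≤ C)
    (hsum : ∑ ω, F ω ≤ C * Fintype.card (Samples n s)) :
    (samplesLaw n s).real E ≤ C / a := by
  classical
  have hreal : (samplesLaw n s).real E =
      (Finset.univ.filter (· ∈ E)).card / (Fintype.card (Samples n s) : ℝ) := by
    rw [samplesLaw, measureReal_def, uniformOn_univ,
      Measure.count_apply_finite' E.toFinite MeasurableSpace.measurableSet_top,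
      ENNReal.toReal_div, ENNReal.toReal_natCast, ENNReal.toReal_natCast]
    congr 3
    ext ω
    simp
  rw [hreal]
  refine div_le_of_le_mul₀ (Nat.cast_nonneg _) (by positivity) ?_
  rw [div_mul_eq_mul_div, le_div_iff₀ ha]
  calc ((Finset.univ.filter (· ∈ E)).card : ℝ) * a
      = ∑ _ω ∈ Finset.univ.filter (· ∈ E), a := by rw [Finset.sum_const, nsmul_eq_mul]
    _ ≤ ∑ ω ∈ Finset.univ.filter (· ∈ E), F ω :=
        Finset.sum_le_sum fun ω hω => hE ω (Finset.mem_filter.1 hω).2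
    _ ≤ ∑ ω, F ω :=
        Finset.sum_le_sum_of_subset_of_nonneg (Finset.filter_subset _ _) fun ω _ _ => hF ω
    _ ≤ _ := hsum

lemma samplesLaw_disagreement_le {ε : ℝ} (hε : 0 < ε) (W : View n V) (q : ℕ)
    (A : Adversary n s V) {m : ℕ} (hm : n + W.byz.card < 2 * (m + 1)) (t : ℕ) :
    (samplesLaw n s).real {ω | Disagreement W (run W q A ω t).2} ≤
      (n * n : ℝ) / ((1 + ε) ^ q / (1 + ε * (s / n)) ^ m) := by
  refine samplesLaw_real_le
    (F := fun ω => ∑ i, potential (hitWeight ε i) W ω (run W q A ω t).2) (by positivity)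
    (fun ω => Finset.sum_nonneg fun i _ => potential_nonneg (hitWeight_nonneg hε i) W ω _)
    ?_ (by positivity) ?_
  · intro ω hω
    obtain ⟨i, x, hx, hcard, Q, hQT, rfl, hQ⟩ := (invariant_run W q A ω t).exists_minority_quorum hω
    refine (le_tilt_hitWeight hε i ω hQT hQ (m := m) (by omega)).trans ?_
    refine (tilt_le_potential (hitWeight_nonneg hε i) W ω hx).trans ?_
    exact Finset.single_le_sum
      (f := fun i => potential (hitWeight ε i) W ω (run W Q.card A ω t).2)
      (fun i _ => potential_nonneg (hitWeight_nonneg hε i) W ω _) (Finset.mem_univ i)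
  · rw [Finset.sum_comm]
    refine (Finset.sum_le_sum fun i _ => sum_potential_run_le (hitWeight_nonneg hε i)
      (sum_hitWeight_sub_one hε i) W q A t).trans_eq ?_
    simp [mul_assoc]

/-- Disagreement persists once reached, so continuity from below passes a bound uniform in `t` to
the union over all times. -/
lemma violationProb_le_of_forall (W : View n V) (q : ℕ) (A : Adversary n s V) {B : ℝ}
    (h : ∀ t, (samplesLaw n s).real {ω | Disagreement W (run W q A ω t).2} ≤ B) :
    violationProb W q A ≤ B := by
  have hfin : IsFiniteMeasure (samplesLaw n s) := by unfold samplesLaw uniformOn; infer_instance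
  have hmono : Monotone fun t => {ω : Samples n s | Disagreement W (run W q A ω t).2} :=
    fun t u htu ω hω => disagreement_run_mono W q A ω htu hω
  have hlim := tendsto_measure_iUnion_atTop (μ := samplesLaw n s) hmono
  have hlim' := (ENNReal.tendsto_toReal (measure_ne_top (samplesLaw n s) _)).comp hlim
  have hset : {ω : Samples n s | ∃ t, Disagreement W (run W q A ω t).2} =
      ⋃ t, {ω | Disagreement W (run W q A ω t).2} := by
    ext ω; simp
  rw [violationProb, hset]
  exact le_of_tendsto hlim' (Eventually.of_forall h)

lemma violationProb_le_one (W : View n V) (q : ℕ) (A : Adversary n s V) :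
    violationProb W q A ≤ 1 := by
  refine violationProb_le_of_forall W q A fun t => ?_
  rw [← div_one (1 : ℝ)]
  exact samplesLaw_real_le (F := fun _ => 1) one_pos (fun _ => zero_le_one) (fun _ _ => le_rfl)
    zero_le_one (by simp)

/-- The Chernoff bound for the prepare quorum of a minority value. -/
lemma violationProb_le_exp {o δ₀ : ℝ} (ho : 1 < o) (hδ₀ : 0 < δ₀) {f q : ℕ} (hn : 0 < n)
    (hs : (s : ℝ) < o * q + 1) (hδ : δ₀ ≤ n / (o * (((n : ℝ) + f) / 2)) - 1)
    (W : View n V) (hW : W.byz.card ≤ f) (A : Adversary n s V) :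
    violationProb W q A ≤
      (n : ℝ) ^ 2 * Real.exp (1 - (Real.log (1 + δ₀) - δ₀ / (1 + δ₀)) * q) := by
  have hn' : (0 : ℝ) < n := by exact_mod_cast hn
  -- The choice `ε = δ₀` is the Chernoff tilt for a threshold `1 + δ₀` times the mean.
  refine (violationProb_le_of_forall W q A fun t =>
    samplesLaw_disagreement_le hδ₀ W q A (m := (n + W.byz.card) / 2) (by omega) t).trans ?_
  set m := (n + W.byz.card) / 2 with hm
  have hm' : (m : ℝ) ≤ (n + f) / 2 := by
    have : 2 * m ≤ n + f := by omega
    have : (2 * m : ℝ) ≤ n + f := by exact_mod_cast this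
    linarith
  have hr : o * (1 + δ₀) * m ≤ n := by
    have h1 : 1 + δ₀ ≤ n / (o * (((n : ℝ) + f) / 2)) := by linarith
    rw [le_div_iff₀ (by positivity)] at h1
    calc o * (1 + δ₀) * m ≤ o * (1 + δ₀) * ((n + f) / 2) := by gcongr
      _ = (1 + δ₀) * (o * (((n : ℝ) + f) / 2)) := by ring
      _ ≤ n := h1
  have hpm : (s / n : ℝ) * m ≤ (q + 1) / (1 + δ₀) := by
    rw [div_mul_eq_mul_div, div_le_div_iff₀ hn' (by positivity)]
    -- Since `o > 1`, the rounding error of `s` costs at most one unit of `q`; it is the source of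
    -- the constant `1` in the exponent.
    have h1 : (s : ℝ) ≤ o * (q + 1) := by nlinarith
    calc (s : ℝ) * m * (1 + δ₀) ≤ o * (q + 1) * m * (1 + δ₀) := by gcongr
      _ = (q + 1) * (o * (1 + δ₀) * m) := by ring
      _ ≤ (q + 1) * n := by gcongr
  have hpow : (1 + δ₀ * (s / n : ℝ)) ^ m ≤ Real.exp (δ₀ / (1 + δ₀) * (q + 1)) := by
    calc (1 + δ₀ * (s / n : ℝ)) ^ m ≤ Real.exp (δ₀ * (s / n)) ^ m := by
          gcongr
          rw [add_comm]
          exact Real.add_one_le_exp _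
      _ = Real.exp (δ₀ * ((s / n) * m)) := by rw [← Real.exp_nat_mul]; ring_nf
      _ ≤ Real.exp (δ₀ * ((q + 1) / (1 + δ₀))) := by gcongr
      _ = _ := by ring_nf
  have hq : (1 + δ₀) ^ q = Real.exp (Real.log (1 + δ₀) * q) := by
    rw [mul_comm, Real.exp_nat_mul, Real.exp_log (by positivity)]
  have hle : δ₀ / (1 + δ₀) ≤ 1 := (div_le_one (by positivity)).2 (by linarith)
  rw [div_div_eq_mul_div, hq, mul_div_assoc, ← pow_two]
  gcongr
  rw [div_le_iff₀ (Real.exp_pos _), ← Real.exp_add]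
  refine hpow.trans (Real.exp_le_exp.2 ?_)
  nlinarith

end Bound

/-! ### Positivity of the rate and absorption of the polynomial factor. -/

lemma div_one_add_lt_log_one_add {x : ℝ} (hx : 0 < x) : x / (1 + x) < Real.log (1 + x) := by
  have h := Real.log_lt_sub_one_of_pos (x := (1 + x)⁻¹) (by positivity)
    (by rw [ne_eq, inv_eq_one]; linarith)
  rw [Real.log_inv] at h
  have : x / (1 + x) = 1 - (1 + x)⁻¹ := by field_simp; ring
  linarith

lemma eventually_log_add_le_sqrt (a : ℝ) {b : ℝ} (hb : 0 < b) :
    ∀ᶠ n : ℕ in atTop, 2 * Real.log n + a ≤ b * √(n : ℝ) := by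
  have hlog : (fun x : ℝ => 2 * Real.log x + a) =o[atTop] fun x : ℝ => √x := by
    simp only [Real.sqrt_eq_rpow]
    refine ((isLittleO_log_rpow_atTop (by norm_num)).const_mul_left 2).add ?_
    exact isLittleO_const_left.2 (Or.inr
      (tendsto_norm_atTop_atTop.comp (tendsto_rpow_atTop (by norm_num))))
  filter_upwards [tendsto_natCast_atTop_atTop.eventually (hlog.bound hb)] with n hn
  refine (le_abs_self _).trans ?_
  simpa [abs_of_nonneg (Real.sqrt_nonneg _)] using hn

end ProBFT

theorem mainTheorem4 (o l δ₀ : ℝ) (ho : 1 < o) (hl : 1 ≤ l) (hδ₀ : 0 < δ₀) :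
    ∃ g : ℕ → ℝ, g =Θ[atTop] (fun n : ℕ => √(n : ℝ)) ∧
      ∀ (n f q s : ℕ),
        3 * f < n →
        |(q : ℝ) - l * √(n : ℝ)| < 1 →
        |(s : ℝ) - o * q| < 1 →
        s ≤ n →
        δ₀ ≤ n / (o * (((n : ℝ) + f) / 2)) - 1 →
        ∀ (V : Type*) (W : ProBFT.View n V),
          W.byz.card ≤ f →
          W.leader ∈ W.byz →
          ∀ A : ProBFT.Adversary n s V,
            ProBFT.violationProb W q A ≤ Real.exp (-(g n)) ^ 4 := by
  set κ := Real.log (1 + δ₀) - δ₀ / (1 + δ₀) with hκdef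
  have hκ : 0 < κ := sub_pos.2 (ProBFT.div_one_add_lt_log_one_add hδ₀)
  have hlarge := ProBFT.eventually_log_add_le_sqrt (1 + κ) (half_pos hκ)
  -- Half of the rate `κ` absorbs `n ^ 2` and the rounding constants `1 + κ`; the fourth power
  -- splits the other half into four times `κ / 8`. For the finitely many other `n` the value `0`
  -- gives the trivial bound one.
  refine ⟨fun n => if 2 * Real.log n + (1 + κ) ≤ κ / 2 * √(n : ℝ) then κ / 8 * √(n : ℝ) else 0,
    ?_, ?_⟩
  · have h : (fun n : ℕ => κ / 8 * √(n : ℝ)) =Θ[atTop] fun n : ℕ => √(n : ℝ) :=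
      (isTheta_const_mul_left (by positivity)).2 (isTheta_refl _ _)
    refine EventuallyEq.trans_isTheta ?_ h
    filter_upwards [hlarge] with n hn
    exact if_pos hn
  · intro n f q s hf hq hs _ hδ V W hW _ A
    dsimp only
    split_ifs with hn
    · have hn0 : 0 < n := by omega
      have hn0' : (0 : ℝ) < n := by exact_mod_cast hn0
      refine (ProBFT.violationProb_le_exp ho hδ₀ hn0 (by linarith [(abs_lt.1 hs).2]) hδ W hW
        A).trans ?_
      rw [← hκdef, ← Real.exp_nat_mul, ← Real.exp_log (pow_pos hn0' 2), ← Real.exp_add,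
        Real.log_pow]
      refine Real.exp_le_exp.2 ?_
      have hq' : √(n : ℝ) - 1 ≤ q := by
        have h1 := (abs_lt.1 hq).1
        have h2 : √(n : ℝ) ≤ l * √(n : ℝ) := le_mul_of_one_le_left (Real.sqrt_nonneg _) hl
        linarith
      have h3 := mul_le_mul_of_nonneg_left hq' hκ.le
      push_cast
      linarith
    · simpa using ProBFT.violationProb_le_one W q A
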